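/- Let $(\Omega,\mathcal F,\mathrm P)$ be a probability space, $0<T<\infty$, and let $(\mathcal F_t)_{t\in[0,T]}$ be a right-continuous filtration such that $\mathcal F_0$ contains only sets of probability $0$ or $1$ and contains all $\mathrm P$-null sets of $\mathcal F$. Let $\Phi:[0,\infty)\to[0,\infty]$ be lower semicontinuous and convex with $\Phi(x_0)<\infty$ for some $x_0>0$, $\inf_{x\ge 0}\Phi(x)=0$ and $\lim_{x\to\infty}\Phi(x)/x=\infty$, and put $\Phi^*(y)=\sup_{x\ge 0}(xy-\Phi(x))$ for $y\in\mathbb R$. Let $Y=(Y_t)_{t\in[0,T]}$ be a nonnegative, right-continuous, $(\mathcal F_t)$-adapted real-valued process such that $\sup_{t\in[0,T]}Y_t$ is almost surely finite and belongs to the Orlicz heart $H^{\Phi^*}$, i.e. $\mathrm E[\Phi^*(c\,\sup_{t\in[0,T]}Y_t)]<\infty$ for every $c>0$. Let $\mathcal T$ be the set of $(\mathcal F_t)$-stopping times with values in $[0,T]$, and let $\mathcal T^r$ be the set of randomized stopping times with values in $[0,T]$, i.e. of maps $\tau^r:\Omega\times[0,1]\to[0,T]$ that are nondecreasing and left-continuous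 in the second variable and such that $\tau^r(\cdot,u)\in\mathcal T$ for every $u\in[0,1]$. For $\tau^r\in\mathcal T^r$ write $Y^r_{\tau^r}(\omega,u)=Y_{\tau^r(\omega,u)}(\omega)$, a random variable on $\Omega\times[0,1]$ equipped with the product of $\mathrm P$ and the uniform distribution on $[0,1]$; expectations of functions of $Y^r_{\tau^r}$ are taken with respect to this product measure. **Proposition 6.1.** Assume that $Y$ is quasi-left-continuous, that is, $Y_{\tau_n}\to Y_\tau$ $\mathrm P$-a.s. whenever $(\tau_n)_{n\in\mathbb N}$ is a sequence in $\mathcal T$ with $\tau_n\nearrow\tau$ for some $\tau\in\mathcal T$. Assume further that $\mathcal F_T$ is countably generated (it is enough that it is so up to $\mathrm P$-null sets: there is a countable family $\mathcal C\subseteq\mathcal F_T$ such that every set in $\mathcal F_T$ coincides $\mathrm P$-a.s. with a set in $\sigma(\mathcal C)$). Then there exists $\tau^r_*\in\mathcal T^r$ such that $$\inf_{x\in\mathbb R}\mathrm E\big[\Phi^*(x+Y^r_{\tau^r_*})-x\big]=\sup_{\tau^r\in\mathcal T^r}\ \inf_{x\in\mathbb R}\mathrm E\big[\Phi^*(x+Y^r_{\tau^r})-x\big],$$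 where infima and suprema are taken in $[-\infty,\infty]$. -/

import Mathlib

open MeasureTheory Filter Topology
open scoped NNReal ENNReal

noncomputable section

namespace RandomizedStopping

/-- The expectation `E[X] = E[X⁺] - E[X⁻]` of an extended real valued random variable. -/
def expectation {Ω : Type*} [MeasurableSpace Ω] (P : Measure Ω) (X : Ω → EReal) : EReal :=
  ((∫⁻ ω, (X ω).toENNReal ∂P : ℝ≥0∞) : EReal) - ((∫⁻ ω, (-X ω).toENNReal ∂P : ℝ≥0∞) : EReal)

/-- The Fenchel-Legendre transform `y ↦ sup_{x ≥ 0} (x y - Φ x)` of `Φ : [0,∞) → [0,∞]`. -/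
def fenchel (Φ : ℝ≥0 → ℝ≥0∞) (y : ℝ) : EReal :=
  ⨆ x : ℝ≥0, ((((x : ℝ) * y : ℝ) : EReal) - (Φ x : EReal))

/-- The restriction to `[0,∞)` of the Fenchel-Legendre transform. It is nonnegative as soon as
`inf Φ = 0`, so that nothing is lost in regarding its values as elements of `[0,∞]`. -/
def fenchelYoung (Φ : ℝ≥0 → ℝ≥0∞) (y : ℝ≥0) : ℝ≥0∞ :=
  (fenchel Φ (y : ℝ)).toENNReal

/-- Membership in the Orlicz heart of `Ψ : [0,∞) → [0,∞]`: the real random variable `X`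
satisfies `E[Ψ (c |X|)] < ∞` for all `c > 0`. -/
def MemOrliczHeart {Ω : Type*} [MeasurableSpace Ω] (P : Measure Ω) (Ψ : ℝ≥0 → ℝ≥0∞)
    (X : Ω → ℝ) : Prop :=
  AEMeasurable X P ∧ ∀ c : ℝ≥0, 0 < c → ∫⁻ ω, Ψ (c * ‖X ω‖₊) ∂P < ∞

/-- The σ-algebra `𝓖` is countably generated up to null sets: every member of `𝓖` agrees almost
surely with a member of the σ-algebra generated by some fixed countable subfamily of `𝓖`. -/
def CountablyGeneratedModNull {Ω : Type*} [MeasurableSpace Ω] (P : Measure Ω)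
    (𝓖 : MeasurableSpace Ω) : Prop :=
  ∃ C : Set (Set Ω), C.Countable ∧ (∀ s ∈ C, MeasurableSet[𝓖] s) ∧
    ∀ s, MeasurableSet[𝓖] s → ∃ t, MeasurableSet[MeasurableSpace.generateFrom C] t ∧ s =ᵐ[P] t

/-- The condition covers every σ-algebra that is countably generated in the strict sense. -/
theorem CountablyGeneratedModNull.of_countablyGenerated {Ω : Type*}
    (𝓖 : MeasurableSpace Ω) [MeasurableSpace Ω] (P : Measure Ω) (h : @MeasurableSpace.CountablyGenerated Ω 𝓖) :
    CountablyGeneratedModNull P 𝓖 := by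
  obtain ⟨C, hC, h⟩ := h.isCountablyGenerated
  subst h
  exact ⟨C, hC, fun s hs => MeasurableSpace.measurableSet_generateFrom hs,
    fun s hs => ⟨s, hs, Filter.EventuallyEq.rfl⟩⟩

/-- A (nonrandomized) stopping time with values in `[0,T]`. -/
def IsStopping {Ω : Type*} [m : MeasurableSpace Ω] {T : ℝ}
    (𝓕 : Filtration (Set.Icc (0 : ℝ) T) m) (τ : Ω → Set.Icc (0 : ℝ) T) : Prop :=
  IsStoppingTime 𝓕 (fun ω => (τ ω : WithTop (Set.Icc (0 : ℝ) T)))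

/-- A randomized stopping time with values in `[0,T]`: it is nondecreasing and left-continuous in
the second variable `u ∈ [0,1]`, and `τ (·, u)` is a stopping time for every `u ∈ [0,1]`. -/
structure IsRandomizedStopping {Ω : Type*} [m : MeasurableSpace Ω] {T : ℝ}
    (𝓕 : Filtration (Set.Icc (0 : ℝ) T) m)
    (τ : Ω → unitInterval → Set.Icc (0 : ℝ) T) : Prop where
  monotone : ∀ ω, Monotone (τ ω)
  leftContinuous : ∀ ω u, ContinuousWithinAt (τ ω) (Set.Iio u) u
  isStopping : ∀ u, IsStopping 𝓕 (fun ω => τ ω u)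

/-- Quasi-left-continuity: `Y` converges almost surely along every nondecreasing sequence of
stopping times with values in `[0,T]`, to its value at the limit. -/
def QuasiLeftContinuous {Ω : Type*} [m : MeasurableSpace Ω] {T : ℝ} (P : Measure Ω)
    (𝓕 : Filtration (Set.Icc (0 : ℝ) T) m) (Y : Set.Icc (0 : ℝ) T → Ω → ℝ) : Prop :=
  ∀ (σ : ℕ → Ω → Set.Icc (0 : ℝ) T) (τ : Ω → Set.Icc (0 : ℝ) T),
    (∀ n, IsStopping 𝓕 (σ n)) → IsStopping 𝓕 τ →
    (∀ ω, Monotone (fun n => σ n ω)) →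
    (∀ ω, Tendsto (fun n => σ n ω) atTop (𝓝 (τ ω))) →
    ∀ᵐ ω ∂P, Tendsto (fun n => Y (σ n ω) ω) atTop (𝓝 (Y (τ ω) ω))

/-- The value `inf_{x ∈ ℝ} E[Φ*(x + Y_τ) - x]` of a randomized stopping time `τ`, where the
expectation is with respect to the product of `P` and the uniform distribution on `[0,1]`. -/
def value {Ω : Type*} [MeasurableSpace Ω] {T : ℝ} (P : Measure Ω) (Φ : ℝ≥0 → ℝ≥0∞)
    (Y : Set.Icc (0 : ℝ) T → Ω → ℝ) (τ : Ω → unitInterval → Set.Icc (0 : ℝ) T) : EReal :=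
  ⨅ x : ℝ, expectation (P.prod (volume : Measure unitInterval))
    (fun p => fenchel Φ (x + Y (τ p.1 p.2) p.1) - (x : EReal))

end RandomizedStopping

end

/-! The objective `V τ = inf_x E[ψ_x(Y_τ)]`, with `ψ_x(y) = Φ*(x + y) - x`, is an infimum of
functionals that are affine when the conditional distributions of randomized stopping times are
averaged (`mixture`). Its superlevel sets are therefore stable under averaging.

A Hilbert space argument replaces compactness. Each `τ` is identified with its random distribution
function in `L²(P × ν)`, where `ν` charges every point of a dense sequence. Almost minimizers of the
norm in decreasing superlevel sets form a Cauchy sequence (`exists_cauchySeq_mem_of_antitone`), so a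
maximizing sequence can be chosen whose distribution functions converge almost surely at every point
of a dense set (`exists_mem_forall_tendsto_distr`). Then the quantile functions converge for almost
every `u`, and right-continuity of the filtration makes the limit a randomized stopping time.

Each functional is continuous along this sequence: for almost every `u` genuine stopping times
converge almost surely, and right-continuity with quasi-left-continuity of `Y` transfers this to `Y`
along subsequences (`exists_subseq_tendsto_of_quasiLeftContinuous`). The Orlicz heart condition
supplies the dominating function. -/

noncomputable section

namespace RandomizedStopping

/-! ### Stopping times and limits of the process along them -/

section Times

variable {Ω ι : Type*} [m : MeasurableSpace Ω] [CompleteLinearOrder ι]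

/-- An everywhere finite stopping time with values in the index set. -/
def IsTime (𝓕 : Filtration ι m) (τ : Ω → ι) : Prop :=
  ∀ t, MeasurableSet[𝓕 t] {ω | τ ω ≤ t}

variable {𝓕 : Filtration ι m}

lemma isTime_const (t : ι) : IsTime 𝓕 (fun _ : Ω => t) := fun _ => MeasurableSet.const _

lemma IsTime.min {σ τ : Ω → ι} (hσ : IsTime 𝓕 σ) (hτ : IsTime 𝓕 τ) :
    IsTime 𝓕 (fun ω => min (σ ω) (τ ω)) := fun t => by
  simp only [min_le_iff]
  exact (hσ t).union (hτ t)

lemma IsTime.iSup {κ : Type*} [Countable κ] {τ : κ → Ω → ι} (h : ∀ k, IsTime 𝓕 (τ k)) :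
    IsTime 𝓕 (fun ω => ⨆ k, τ k ω) := fun t => by
  have : {ω | ⨆ k, τ k ω ≤ t} = ⋂ k, {ω | τ k ω ≤ t} := by ext; simp
  rw [this]
  exact MeasurableSet.iInter fun k => h k t

variable [TopologicalSpace ι] [OrderTopology ι]

section
variable [DenselyOrdered ι] [FirstCountableTopology ι]

lemma IsTime.measurableSet_lt {τ : Ω → ι} (h : IsTime 𝓕 τ) (t : ι) :
    MeasurableSet[𝓕 t] {ω | τ ω < t} := by
  rcases eq_bot_or_bot_lt t with rfl | ht
  · simp
  obtain ⟨u, -, hu, hut⟩ := exists_seq_strictMono_tendsto' ht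
  have : {ω | τ ω < t} = ⋃ n, {ω | τ ω ≤ u n} := by
    ext ω
    simp only [Set.mem_ofPred_eq, Set.mem_iUnion]
    refine ⟨fun hω => ?_, fun ⟨n, hn⟩ => hn.trans_lt (hu n).2⟩
    obtain ⟨n, hn⟩ := (hut.eventually (lt_mem_nhds hω)).exists
    exact ⟨n, hn.le⟩
  rw [this]
  exact MeasurableSet.iUnion fun n => 𝓕.mono (hu n).2.le _ (h (u n))

lemma isTime_of_measurableSet_lt (h𝓕 : 𝓕.IsRightContinuous) {τ : Ω → ι}
    (h : ∀ t, MeasurableSet[𝓕 t] {ω | τ ω < t}) : IsTime 𝓕 τ := by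
  intro t
  rcases eq_top_or_lt_top t with rfl | ht
  · simp
  apply h𝓕.measurableSet
  rw [Filtration.rightCont_eq_of_not_isMax _ (by rw [isMax_iff_eq_top]; exact ht.ne)]
  simp only [MeasurableSpace.measurableSet_iInf]
  intro j hj
  obtain ⟨u, -, hu, hut⟩ := exists_seq_strictAnti_tendsto' hj
  have : {ω | τ ω ≤ t} = ⋂ n, {ω | τ ω < u n} := by
    ext ω
    simp only [Set.mem_ofPred_eq, Set.mem_iInter]
    exact ⟨fun hω n => hω.trans_lt (hu n).1, fun hω => ge_of_tendsto' hut fun n => (hω n).le⟩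
  rw [this]
  exact MeasurableSet.iInter fun n => 𝓕.mono (hu n).2.le _ (h (u n))

lemma IsTime.iInf (h𝓕 : 𝓕.IsRightContinuous) {κ : Type*} [Countable κ] {τ : κ → Ω → ι}
    (h : ∀ k, IsTime 𝓕 (τ k)) : IsTime 𝓕 (fun ω => ⨅ k, τ k ω) := by
  refine isTime_of_measurableSet_lt h𝓕 fun t => ?_
  have : {ω | ⨅ k, τ k ω < t} = ⋃ k, {ω | τ k ω < t} := by ext; simp [iInf_lt_iff]
  rw [this]
  exact MeasurableSet.iUnion fun k => (h k).measurableSet_lt t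

lemma IsTime.liminf (h𝓕 : 𝓕.IsRightContinuous) {τ : ℕ → Ω → ι} (h : ∀ n, IsTime 𝓕 (τ n)) :
    IsTime 𝓕 (fun ω => liminf (fun n => τ n ω) atTop) := by
  simp only [liminf_eq_iSup_iInf_of_nat']
  exact IsTime.iSup fun n => IsTime.iInf h𝓕 fun k => h (k + n)

end

variable [SecondCountableTopology ι] [MeasurableSpace ι] [BorelSpace ι]

lemma IsTime.measurable {τ : Ω → ι} (h : IsTime 𝓕 τ) : Measurable τ :=
  measurable_of_Iic fun t => 𝓕.le t _ (h t)

/-- A right-continuous process which is continuous along nondecreasing sequences of stopping times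
is continuous, along a subsequence, for each almost sure limit of stopping times. -/
theorem exists_subseq_tendsto_of_quasiLeftContinuous [DenselyOrdered ι]
    {P : Measure Ω} [IsFiniteMeasure P]
    (h𝓕 : 𝓕.IsRightContinuous) {Y : ι → Ω → ℝ}
    (hY : ∀ ω t, ContinuousWithinAt (fun s => Y s ω) (Set.Ioi t) t)
    (hq : ∀ (σ : ℕ → Ω → ι) (τ : Ω → ι), (∀ n, IsTime 𝓕 (σ n)) → IsTime 𝓕 τ →
      (∀ ω, Monotone fun n => σ n ω) → (∀ ω, Tendsto (fun n => σ n ω) atTop (𝓝 (τ ω))) →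
      ∀ᵐ ω ∂P, Tendsto (fun n => Y (σ n ω) ω) atTop (𝓝 (Y (τ ω) ω)))
    {σ : ℕ → Ω → ι} {τ : Ω → ι} (hσ : ∀ n, IsTime 𝓕 (σ n)) (hτ : IsTime 𝓕 τ)
    (hlim : ∀ᵐ ω ∂P, Tendsto (fun n => σ n ω) atTop (𝓝 (τ ω))) :
    ∃ k : ℕ → ℕ, ∀ᵐ ω ∂P, Tendsto (fun j => Y (σ (k j) ω) ω) atTop (𝓝 (Y (τ ω) ω)) := by
  -- These stopping times increase to `τ` almost surely, but `σ k` itself need not be monotone; it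
  -- has to be fitted between them.
  set ρ : ℕ → Ω → ι := fun k ω => ⨅ n, min (σ (n + k) ω) (τ ω) with hρ_def
  have hρ : ∀ k, IsTime 𝓕 (ρ k) := fun k => IsTime.iInf h𝓕 fun n => (hσ _).min hτ
  have hρ_mono : ∀ ω, Monotone fun k => ρ k ω := by
    intro ω
    refine monotone_nat_of_le_succ fun k => le_iInf fun n => ?_
    have := iInf_le (fun n => min (σ (n + k) ω) (τ ω)) (n + 1)
    rwa [add_right_comm, add_assoc] at this
  have hρ_le : ∀ k ω, ρ k ω ≤ min (σ k ω) (τ ω) := fun k ω => by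
    simpa using iInf_le (fun n => min (σ (n + k) ω) (τ ω)) 0
  have hρ_lim : ∀ᵐ ω ∂P, ⨆ k, ρ k ω = τ ω := by
    filter_upwards [hlim] with ω hω
    have h1 : Tendsto (fun n => min (σ n ω) (τ ω)) atTop (𝓝 (τ ω)) := by
      simpa using hω.min (tendsto_const_nhds (x := τ ω))
    rw [← h1.liminf_eq, liminf_eq_iSup_iInf_of_nat']
  -- As `ρ n` increases to `τ`, it eventually exceeds `σ k` wherever `σ k < τ`, so these events
  -- decrease to a null set.
  have hE : ∀ k, ∃ n, k < n ∧ P {ω | σ k ω < τ ω ∧ ρ n ω ≤ σ k ω} < 2⁻¹ ^ k := by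
    intro k
    have hanti : Antitone fun n => {ω | σ k ω < τ ω ∧ ρ n ω ≤ σ k ω} :=
      fun a b hab ω hω => ⟨hω.1, (hρ_mono ω hab).trans hω.2⟩
    have hmeas : ∀ n, MeasurableSet {ω | σ k ω < τ ω ∧ ρ n ω ≤ σ k ω} := fun n =>
      (measurableSet_lt (hσ k).measurable hτ.measurable).inter
        (measurableSet_le (hρ n).measurable (hσ k).measurable)
    have ht := tendsto_measure_iInter_atTop (μ := P) (fun n => (hmeas n).nullMeasurableSet) hanti
      ⟨0, measure_ne_top _ _⟩
    have h0 : P (⋂ n, {ω | σ k ω < τ ω ∧ ρ n ω ≤ σ k ω}) = 0 := by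
      refine measure_mono_null (fun ω hω => ?_) hρ_lim
      simp only [Set.mem_iInter, Set.mem_ofPred_eq] at hω
      exact ((iSup_le fun n => (hω n).2).trans_lt (hω 0).1).ne
    rw [h0] at ht
    obtain ⟨n, hn, hkn⟩ := ((ht.eventually (gt_mem_nhds
      (show (0 : ℝ≥0∞) < 2⁻¹ ^ k from ENNReal.pow_pos (by simp) k))).and
      (eventually_gt_atTop k)).exists
    exact ⟨n, hkn, hn⟩
  choose f hf hfE using hE
  set k : ℕ → ℕ := fun j => f^[j] 0 with hk_def
  have hk_succ : ∀ j, k (j + 1) = f (k j) := fun j => Function.iterate_succ_apply' f j 0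
  have hk_mono : StrictMono k := strictMono_nat_of_lt_succ fun j => by rw [hk_succ]; exact hf _
  have hBC : ∀ᵐ ω ∂P, ∀ᶠ j in atTop, ω ∉ {ω | σ (k j) ω < τ ω ∧ ρ (k (j + 1)) ω ≤ σ (k j) ω} := by
    refine ae_eventually_notMem (ne_top_of_le_ne_top (b := ∑' j : ℕ, (2⁻¹ : ℝ≥0∞) ^ j) ?_ ?_)
    · rw [ENNReal.tsum_geometric]; simp
    · refine ENNReal.tsum_le_tsum fun j => ?_
      rw [hk_succ]
      exact (hfE (k j)).le.trans (pow_le_pow_of_le_one (by simp) (by simp) (hk_mono.id_le j))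
  -- Interlacing `ρ (k j) ≤ π j ≤ ρ (k (j + 1))` makes `π` monotone, so quasi-left-continuity
  -- applies. By Borel–Cantelli, `π j` eventually equals `σ (k j)` whenever `σ (k j) < τ`; the
  -- indices with `σ (k j) ≥ τ` are left to right-continuity.
  set π : ℕ → Ω → ι := fun j ω => min (min (σ (k j) ω) (τ ω)) (ρ (k (j + 1)) ω) with hπ_def
  have hπ : ∀ j, IsTime 𝓕 (π j) := fun j => ((hσ _).min hτ).min (hρ _)
  have hρπ : ∀ j ω, ρ (k j) ω ≤ π j ω := fun j ω =>
    le_min (hρ_le _ _) (hρ_mono ω (hk_mono j.lt_succ_self).le)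
  have hπρ : ∀ j ω, π j ω ≤ ρ (k (j + 1)) ω := fun j ω => min_le_right _ _
  have hρ_tendsto : ∀ ω, Tendsto (fun j => ρ (k j) ω) atTop (𝓝 (⨆ k, ρ k ω)) := fun ω =>
    (tendsto_atTop_iSup (hρ_mono ω)).comp hk_mono.tendsto_atTop
  have hπY := hq π (fun ω => ⨆ k, ρ k ω) hπ (IsTime.iSup hρ)
    (fun ω => monotone_nat_of_le_succ fun j => (hπρ j ω).trans (hρπ (j + 1) ω))
    (fun ω => tendsto_of_tendsto_of_tendsto_of_le_of_le (hρ_tendsto ω)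
      ((tendsto_add_atTop_iff_nat 1).2 (hρ_tendsto ω)) (fun j => hρπ j ω) (fun j => hπρ j ω))
  refine ⟨k, ?_⟩
  filter_upwards [hlim, hρ_lim, hBC, hπY] with ω h1 h2 h3 h4
  rw [h2] at h4
  have h5 : Tendsto (fun j => Y (max (σ (k j) ω) (τ ω)) ω) atTop (𝓝 (Y (τ ω) ω)) := by
    have hc : ContinuousWithinAt (fun s => Y s ω) (Set.Ici (τ ω)) (τ ω) :=
      continuousWithinAt_Ioi_iff_Ici.1 (hY ω (τ ω))
    refine hc.tendsto.comp (tendsto_nhdsWithin_iff.2 ⟨?_, .of_forall fun j => le_max_right _ _⟩)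
    simpa using (h1.comp hk_mono.tendsto_atTop).max (tendsto_const_nhds (x := τ ω))
  rw [tendsto_def] at h4 h5 ⊢
  intro s hs
  filter_upwards [h4 s hs, h5 s hs, h3] with j h6 h7 h8
  rcases lt_or_ge (σ (k j) ω) (τ ω) with h | h
  · have h9 : σ (k j) ω < ρ (k (j + 1)) ω := not_le.1 fun h9 => h8 ⟨h, h9⟩
    simpa [hπ_def, min_eq_left h.le, min_eq_left h9.le] using h6
  · simpa [max_eq_left h] using h7

end Times

/-! ### Distribution and quantile functions on the unit interval -/

section Quantile

variable {ι : Type*} [CompleteLinearOrder ι]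

/-- The distribution function of a function on `[0,1]` under the uniform distribution. -/
def distr (f : unitInterval → ι) (t : ι) : ℝ := (volume : Measure unitInterval).real {u | f u ≤ t}

lemma distr_nonneg (f : unitInterval → ι) (t : ι) : 0 ≤ distr f t := measureReal_nonneg

lemma distr_le_one (f : unitInterval → ι) (t : ι) : distr f t ≤ 1 := measureReal_le_one

lemma distr_top (f : unitInterval → ι) : distr f ⊤ = 1 := by simp [distr]

lemma distr_mono (f : unitInterval → ι) : Monotone (distr f) := fun _ _ h =>
  measureReal_mono fun _ hu => le_trans hu h

lemma volume_real_Iic (u : unitInterval) : (volume : Measure unitInterval).real (Set.Iic u) = u := by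
  rw [measureReal_def, unitInterval.volume_Iic, ENNReal.toReal_ofReal u.2.1]

lemma le_distr {f : unitInterval → ι} (hf : Monotone f) {u : unitInterval} {t : ι} (h : f u ≤ t) :
    (u : ℝ) ≤ distr f t := by
  rw [← volume_real_Iic]
  exact measureReal_mono fun v hv => (hf hv).trans h

lemma distr_le {f : unitInterval → ι} (hf : Monotone f) {u : unitInterval} {t : ι} (h : t < f u) :
    distr f t ≤ u := by
  rw [← volume_real_Iic]
  exact measureReal_mono fun v hv => le_of_not_gt fun huv => ((hf huv.le).trans hv).not_gt h

/-- The quantile function of the average of the distributions of two functions on `[0,1]`. -/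
def mixture (f g : unitInterval → ι) (u : unitInterval) : ι :=
  sInf {t | (u : ℝ) ≤ (distr f t + distr g t) / 2}

lemma mixture_mono (f g : unitInterval → ι) : Monotone (mixture f g) := fun _ _ huv =>
  sInf_le_sInf fun _ ht => le_trans (Subtype.coe_le_coe.2 huv) ht

variable [TopologicalSpace ι] [OrderTopology ι]

lemma leftContinuous_of_le {f : unitInterval → ι} (hf : Monotone f)
    (h : ∀ u ≠ 0, ∀ t, (∀ v < u, f v ≤ t) → f u ≤ t) (u : unitInterval) :
    ContinuousWithinAt f (Set.Iio u) u := by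
  rcases eq_or_ne u 0 with rfl | hu
  · have : Set.Iio (0 : unitInterval) = ∅ := Set.eq_empty_of_forall_notMem fun v hv =>
      absurd hv (not_lt.2 unitInterval.nonneg')
    rw [this]
    simp [ContinuousWithinAt]
  · have h1 := hf.tendsto_nhdsLT u
    have h2 : sSup (f '' Set.Iio u) = f u := by
      refine le_antisymm (sSup_le ?_) (h u hu _ fun v hv => le_sSup ⟨v, hv, rfl⟩)
      rintro _ ⟨v, hv, rfl⟩
      exact hf (le_of_lt hv)
    rwa [h2] at h1

lemma le_of_leftContinuous {f : unitInterval → ι} {u : unitInterval}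
    (hl : ContinuousWithinAt f (Set.Iio u) u) (hu : u ≠ 0) {t : ι} (h : ∀ v < u, f v ≤ t) :
    f u ≤ t := by
  have : (𝓝[<] u).NeBot := nhdsLT_neBot_of_exists_lt ⟨0, unitInterval.pos_iff_ne_zero.2 hu⟩
  exact le_of_tendsto hl.tendsto (eventually_nhdsWithin_of_forall h)

/-- If `t < f v` for some `v < u`, then `distr f t ≤ v < u`; left-continuity extends the bound from
all `v < u` to `u`. The point `0` is excluded because the left side is always true there. -/
lemma le_distr_iff {f : unitInterval → ι} (hf : Monotone f) {u : unitInterval}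
    (hl : ContinuousWithinAt f (Set.Iio u) u) (hu : u ≠ 0) {t : ι} :
    (u : ℝ) ≤ distr f t ↔ f u ≤ t := by
  refine ⟨fun h => le_of_leftContinuous hl hu fun v hv => ?_, le_distr hf⟩
  by_contra hvt
  exact absurd (h.trans (distr_le hf (not_le.1 hvt))) (not_le.2 hv)

variable [SecondCountableTopology ι] [MeasurableSpace ι] [BorelSpace ι]

lemma tendsto_distr {f : unitInterval → ι} (hf : Monotone f) {s : ℕ → ι} (hs : StrictAnti s) {t : ι}
    (hst : ∀ n, t < s n) (hlim : Tendsto s atTop (𝓝 t)) :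
    Tendsto (fun n => distr f (s n)) atTop (𝓝 (distr f t)) := by
  have h : {u | f u ≤ t} = ⋂ n, {u | f u ≤ s n} := by
    ext u
    simp only [Set.mem_ofPred_eq, Set.mem_iInter]
    exact ⟨fun h n => h.trans (hst n).le, fun h => ge_of_tendsto' hlim h⟩
  unfold distr
  rw [h]
  refine (ENNReal.tendsto_toReal (measure_ne_top _ _)).comp (tendsto_measure_iInter_atTop
    (fun n => (hf.measurable measurableSet_Iic).nullMeasurableSet)
    (fun a b hab u hu => le_trans hu (hs.antitone hab)) ⟨0, measure_ne_top _ _⟩)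

variable [DenselyOrdered ι]

/-- The infimum defining the quantile is attained, because distribution functions are
right-continuous. -/
lemma mixture_le_iff {f g : unitInterval → ι} (hf : Monotone f) (hg : Monotone g)
    {u : unitInterval} {t : ι} :
    mixture f g u ≤ t ↔ (u : ℝ) ≤ (distr f t + distr g t) / 2 := by
  refine ⟨fun h => ?_, fun h => sInf_le h⟩
  rcases eq_top_or_lt_top t with rfl | ht
  · rw [distr_top, distr_top]
    linarith [u.2.2]
  obtain ⟨s, hs, hst, hlim⟩ := exists_seq_strictAnti_tendsto' ht
  refine ge_of_tendsto' (((tendsto_distr hf hs (fun n => (hst n).1) hlim).add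
    (tendsto_distr hg hs (fun n => (hst n).1) hlim)).div_const 2) fun n => ?_
  obtain ⟨r, hr, hrs⟩ := sInf_lt_iff.1 (h.trans_lt (hst n).1)
  refine le_trans hr ?_
  linarith [distr_mono f hrs.le, distr_mono g hrs.le]

lemma mixture_leftContinuous {f g : unitInterval → ι} (hf : Monotone f) (hg : Monotone g)
    (u : unitInterval) : ContinuousWithinAt (mixture f g) (Set.Iio u) u := by
  refine leftContinuous_of_le (mixture_mono f g) (fun u hu t h => ?_) u
  rw [mixture_le_iff hf hg]
  have : (𝓝[<] u).NeBot := nhdsLT_neBot_of_exists_lt ⟨0, unitInterval.pos_iff_ne_zero.2 hu⟩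
  exact le_of_tendsto (x := 𝓝[<] u) continuous_subtype_val.continuousWithinAt.tendsto
    (eventually_nhdsWithin_of_forall fun v hv => (mixture_le_iff hf hg).1 (h v hv))

lemma distr_mixture {f g : unitInterval → ι} (hf : Monotone f) (hg : Monotone g) (t : ι) :
    distr (mixture f g) t = (distr f t + distr g t) / 2 := by
  have h : {u | mixture f g u ≤ t} = Set.Iic (⟨(distr f t + distr g t) / 2,
      by linarith [distr_nonneg f t, distr_nonneg g t],
      by linarith [distr_le_one f t, distr_le_one g t]⟩ : unitInterval) := by
    ext u
    exact mixture_le_iff hf hg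
  rw [distr, h, volume_real_Iic]

/-- This identity of laws is what makes expected rewards affine under mixtures. -/
lemma map_mixture {f g : unitInterval → ι} (hf : Monotone f) (hg : Monotone g) :
    (volume : Measure unitInterval).map (mixture f g) =
      (2⁻¹ : ℝ≥0∞) • ((volume : Measure unitInterval).map f + volume.map g) := by
  have : IsFiniteMeasure ((2⁻¹ : ℝ≥0∞) •
      ((volume : Measure unitInterval).map f + volume.map g)) := Measure.smul_finite _ (by simp)
  have key : ∀ {h : unitInterval → ι}, Monotone h → ∀ t,
      volume.map h (Set.Iic t) = ENNReal.ofReal (distr h t) := fun hh t => by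
    rw [Measure.map_apply hh.measurable measurableSet_Iic, distr, measureReal_def,
      ENNReal.ofReal_toReal (measure_ne_top _ _)]
    rfl
  refine Measure.ext_of_Iic _ _ fun t => ?_
  simp only [Measure.smul_apply, Measure.add_apply, key (mixture_mono f g), key hf, key hg,
    distr_mixture hf hg, smul_eq_mul]
  rw [← ENNReal.ofReal_add (distr_nonneg _ _) (distr_nonneg _ _), div_eq_inv_mul,
    ENNReal.ofReal_mul (by norm_num), ENNReal.ofReal_inv_of_pos (by norm_num)]
  simp

lemma integral_mixture {f g : unitInterval → ι} (hf : Monotone f) (hg : Monotone g) {h : ι → ℝ}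
    (hh : Measurable h) {C : ℝ} (hC : ∀ t, |h t| ≤ C) :
    ∫ u, h (mixture f g u) = ((∫ u, h (f u)) + ∫ u, h (g u)) / 2 := by
  have key : ∀ {k : unitInterval → ι}, Monotone k → Integrable h (volume.map k) := fun hk => by
    have := Measure.isFiniteMeasure_map (volume : Measure unitInterval) ‹unitInterval → ι›
    exact Integrable.of_bound hh.aestronglyMeasurable C (.of_forall hC)
  rw [← integral_map (mixture_mono f g).measurable.aemeasurable hh.aestronglyMeasurable,
    map_mixture hf hg, integral_smul_measure, integral_add_measure (key hf) (key hg),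
    integral_map hf.measurable.aemeasurable hh.aestronglyMeasurable,
    integral_map hg.measurable.aemeasurable hh.aestronglyMeasurable]
  simp [div_eq_inv_mul]

end Quantile

/-! ### Randomized stopping times -/

section RandomTimes

variable {Ω ι : Type*} [m : MeasurableSpace Ω] [CompleteLinearOrder ι] [TopologicalSpace ι]

/-- A randomized stopping time with values in the index set. -/
structure IsRandomTime (𝓕 : Filtration ι m) (τ : Ω → unitInterval → ι) : Prop where
  monotone : ∀ ω, Monotone (τ ω)
  leftContinuous : ∀ ω u, ContinuousWithinAt (τ ω) (Set.Iio u) u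
  isTime : ∀ u, IsTime 𝓕 (fun ω => τ ω u)

variable {𝓕 : Filtration ι m}

lemma isRandomTime_bot : IsRandomTime 𝓕 (fun _ _ => ⊥) :=
  ⟨fun _ => monotone_const, fun _ _ => continuousWithinAt_const, fun _ => isTime_const _⟩

variable [OrderTopology ι]

/-- For `0 < a ≤ 1` the event `distr (τ ω) t ≥ a` is `τ ω a ≤ t`. Adaptedness of the distribution
function is what makes a mixture of randomized stopping times one again. -/
lemma IsRandomTime.measurable_distr {τ : Ω → unitInterval → ι} (h : IsRandomTime 𝓕 τ) (t : ι) :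
    Measurable[𝓕 t] (fun ω => distr (τ ω) t) := by
  refine measurable_of_Ici fun a => ?_
  rcases le_or_gt a 0 with ha | ha
  · have : (fun ω => distr (τ ω) t) ⁻¹' Set.Ici a = Set.univ :=
      Set.eq_univ_of_forall fun ω => ha.trans (distr_nonneg (τ ω) t)
    rw [this]
    exact @MeasurableSet.univ _ (𝓕 t)
  rcases lt_or_ge 1 a with ha' | ha'
  · have : (fun ω => distr (τ ω) t) ⁻¹' Set.Ici a = ∅ :=
      Set.eq_empty_of_forall_notMem fun ω hω => ((distr_le_one (τ ω) t).trans_lt ha').not_ge hω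
    rw [this]
    exact @MeasurableSet.empty _ (𝓕 t)
  · have : (fun ω => distr (τ ω) t) ⁻¹' Set.Ici a = {ω | τ ω ⟨a, ha.le, ha'⟩ ≤ t} := by
      ext ω
      exact le_distr_iff (h.monotone ω) (u := ⟨a, ha.le, ha'⟩) (h.leftContinuous ω _)
        (fun h0 => ha.ne' (congrArg Subtype.val h0))
    rw [this]
    exact h.isTime _ t

variable [SecondCountableTopology ι] [MeasurableSpace ι] [BorelSpace ι]

/-- By monotonicity and left-continuity, `τ ω u ≤ t` is decided for `u ≠ 0` by countably many `v <
u`. At `0` left-continuity is void, so that slice is treated separately. -/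
lemma IsRandomTime.measurable {τ : Ω → unitInterval → ι} (h : IsRandomTime 𝓕 τ) :
    Measurable (fun p : Ω × unitInterval => τ p.1 p.2) := by
  refine measurable_of_Iic fun t => ?_
  obtain ⟨D, hDc, hD⟩ := TopologicalSpace.exists_countable_dense unitInterval
  have hset : ∀ v, MeasurableSet {ω | τ ω v ≤ t} := fun v => 𝓕.le t _ (h.isTime v t)
  have : (fun p : Ω × unitInterval => τ p.1 p.2) ⁻¹' Set.Iic t =
      ({ω | τ ω 0 ≤ t} ×ˢ {0}) ∪ ((Set.univ ×ˢ {0}ᶜ) ∩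
        ⋂ v ∈ D, ((Set.univ ×ˢ Set.Iic v) ∪ ({ω | τ ω v ≤ t} ×ˢ Set.univ))) := by
    ext ⟨ω, u⟩
    simp only [Set.mem_preimage, Set.mem_Iic, Set.mem_union, Set.mem_prod, Set.mem_ofPred_eq,
      Set.mem_singleton_iff, Set.mem_inter_iff, Set.mem_univ, Set.mem_compl_iff, true_and,
      Set.mem_iInter, and_true]
    constructor
    · intro hu
      rcases eq_or_ne u 0 with rfl | h0
      · exact Or.inl ⟨hu, rfl⟩
      · refine Or.inr ⟨h0, fun v _ => (le_or_gt u v).imp id fun hvu => ?_⟩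
        exact (h.monotone ω hvu.le).trans hu
    · rintro (⟨hu, rfl⟩ | ⟨h0, hu⟩)
      · exact hu
      · refine le_of_leftContinuous (h.leftContinuous ω u) h0 fun w hw => ?_
        obtain ⟨v, hv, hwv, hvu⟩ := hD.exists_between hw
        exact (h.monotone ω hwv.le).trans ((hu v hv).resolve_left (not_le.2 hvu))
  rw [this]
  refine ((hset 0).prod (measurableSet_singleton 0)).union (.inter
    (MeasurableSet.univ.prod (measurableSet_singleton 0).compl) ?_)
  exact MeasurableSet.biInter hDc fun v _ =>
    (MeasurableSet.univ.prod measurableSet_Iic).union ((hset v).prod MeasurableSet.univ)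

lemma IsRandomTime.measurable_distr_uncurry {τ : Ω → unitInterval → ι} (h : IsRandomTime 𝓕 τ) :
    Measurable (fun p : Ω × ι => distr (τ p.1) p.2) := by
  have hm : MeasurableSet {q : (Ω × ι) × unitInterval | τ q.1.1 q.2 ≤ q.1.2} :=
    measurableSet_le (h.measurable.comp (measurable_fst.fst.prodMk measurable_snd))
      measurable_fst.snd
  exact (measurable_measure_prodMk_left hm).ennreal_toReal

variable [DenselyOrdered ι]

lemma IsRandomTime.mixture {σ τ : Ω → unitInterval → ι} (hσ : IsRandomTime 𝓕 σ)
    (hτ : IsRandomTime 𝓕 τ) : IsRandomTime 𝓕 (fun ω => mixture (σ ω) (τ ω)) where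
  monotone ω := mixture_mono _ _
  leftContinuous ω := mixture_leftContinuous (hσ.monotone ω) (hτ.monotone ω)
  isTime u t := by
    simp only [mixture_le_iff (hσ.monotone _) (hτ.monotone _)]
    exact @measurableSet_le _ _ _ _ _ (𝓕 t) _ _ _ _ _ measurable_const
      (((hσ.measurable_distr t).add (hτ.measurable_distr t)).div_const 2)

end RandomTimes

/-! ### Joint measurability of right-continuous processes -/

section JointMeasurability

variable {Ω ι : Type*} [m : MeasurableSpace Ω] [MeasurableSpace ι]

lemma measurable_comp_simpleFunc {Y : ι → Ω → ℝ} (hm : ∀ t, Measurable (Y t)) (s : SimpleFunc ι ι) :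
    Measurable fun p : ι × Ω => Y (s p.1) p.2 := by
  intro S hS
  have : (fun p : ι × Ω => Y (s p.1) p.2) ⁻¹' S = ⋃ r ∈ s.range, (s ⁻¹' {r}) ×ˢ (Y r ⁻¹' S) := by
    ext ⟨t, ω⟩
    simp only [Set.mem_preimage, SimpleFunc.mem_range, Set.mem_range, Set.iUnion_exists,
      Set.iUnion_iUnion_eq', Set.mem_iUnion, Set.mem_prod, Set.mem_singleton_iff]
    exact ⟨fun h => ⟨t, rfl, h⟩, fun ⟨i, hi, h⟩ => hi ▸ h⟩
  rw [this]
  exact Finset.measurableSet_biUnion _ fun r _ => (s.measurableSet_fiber r).prod (hm r hS)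

variable [CompleteLinearOrder ι] [TopologicalSpace ι] [OrderTopology ι] [BorelSpace ι]

/-- Approximation of the identity from the right by functions with finitely many values. -/
def upperApprox (d : ℕ → ι) : ℕ → SimpleFunc ι ι
  | 0 => SimpleFunc.const ι ⊤
  | n + 1 => SimpleFunc.piecewise (Set.Iio (d n)) measurableSet_Iio
      (upperApprox d n ⊓ SimpleFunc.const ι (d n)) (upperApprox d n)

lemma upperApprox_succ (d : ℕ → ι) (n : ℕ) (t : ι) : upperApprox d (n + 1) t =
    if t < d n then upperApprox d n t ⊓ d n else upperApprox d n t := by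
  simp [upperApprox, SimpleFunc.piecewise_apply]

lemma upperApprox_top (d : ℕ → ι) (n : ℕ) : upperApprox d n ⊤ = ⊤ := by
  induction n with
  | zero => rfl
  | succ n ih => simp [upperApprox_succ, ih]

lemma lt_upperApprox (d : ℕ → ι) (n : ℕ) {t : ι} (ht : t < ⊤) : t < upperApprox d n t := by
  induction n with
  | zero => exact ht
  | succ n ih =>
    rw [upperApprox_succ]
    split_ifs with h
    · exact lt_inf_iff.2 ⟨ih, h⟩
    · exact ih

lemma antitone_upperApprox (d : ℕ → ι) (t : ι) : Antitone fun n => upperApprox d n t := by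
  refine antitone_nat_of_succ_le fun n => ?_
  rw [upperApprox_succ]
  split_ifs with h
  · exact inf_le_left
  · exact le_rfl

lemma tendsto_upperApprox [DenselyOrdered ι] {d : ℕ → ι} (hd : DenseRange d) {t : ι} (ht : t < ⊤) :
    Tendsto (fun n => upperApprox d n t) atTop (𝓝[>] t) := by
  refine tendsto_nhdsWithin_iff.2 ⟨?_, .of_forall fun n => lt_upperApprox d n ht⟩
  refine tendsto_order.2 ⟨fun s hs => .of_forall fun n => hs.trans (lt_upperApprox d n ht), fun s hs => ?_⟩
  obtain ⟨_, ⟨n, rfl⟩, h1, h2⟩ := hd.exists_between hs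
  filter_upwards [eventually_ge_atTop (n + 1)] with k hk
  refine lt_of_le_of_lt (antitone_upperApprox d t hk) ?_
  simp only [upperApprox_succ, if_pos h1]
  exact inf_le_right.trans_lt h2

lemma measurable_uncurry_of_rightContinuous [DenselyOrdered ι] [SecondCountableTopology ι]
    {Y : ι → Ω → ℝ} (hm : ∀ t, Measurable (Y t))
    (hY : ∀ ω t, ContinuousWithinAt (fun s => Y s ω) (Set.Ioi t) t) :
    Measurable fun p : ι × Ω => Y p.1 p.2 := by
  have : Nonempty ι := ⟨⊤⟩
  refine measurable_of_tendsto_metrizable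
    (fun n => measurable_comp_simpleFunc hm (upperApprox (TopologicalSpace.denseSeq ι) n))
    (tendsto_pi_nhds.2 fun ⟨t, ω⟩ => ?_)
  rcases eq_top_or_lt_top t with rfl | ht
  · simp [upperApprox_top]
  · exact (hY ω t).tendsto.comp (tendsto_upperApprox (TopologicalSpace.denseRange_denseSeq ι) ht)

end JointMeasurability

/-! ### Finiteness, convexity and growth of the conjugate function -/

section Conjugate

variable {Φ : ℝ≥0 → ℝ≥0∞}

/-- The Fenchel-Legendre transform as a real valued function. -/
def realFenchel (Φ : ℝ≥0 → ℝ≥0∞) (y : ℝ) : ℝ := (fenchel Φ y).toReal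

lemma coe_sub_toReal {x : ℝ≥0} (hx : Φ x ≠ ∞) (y : ℝ) :
    ((((x : ℝ) * y : ℝ) : EReal) - (Φ x : EReal)) = ((x * y - (Φ x).toReal : ℝ) : EReal) := by
  rw [EReal.coe_sub, EReal.coe_ennreal_toReal hx]

lemma fenchel_ne_bot (h : ∃ x₀, Φ x₀ < ∞) (y : ℝ) : fenchel Φ y ≠ ⊥ := by
  obtain ⟨x, hx⟩ := h
  refine ne_bot_of_le_ne_bot ?_
    (le_iSup (fun x : ℝ≥0 => ((((x : ℝ) * y : ℝ) : EReal) - (Φ x : EReal))) x)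
  rw [coe_sub_toReal hx.ne]
  exact EReal.coe_ne_bot _

/-- Superlinear growth gives `Φ x ≥ x |y|` beyond some `M`, so those terms are nonpositive; the
others are at most `M |y|`. -/
lemma fenchel_ne_top (h : Tendsto (fun x : ℝ≥0 => Φ x / (x : ℝ≥0∞)) atTop (𝓝 ∞)) (y : ℝ) :
    fenchel Φ y ≠ ⊤ := by
  obtain ⟨M, hM⟩ := eventually_atTop.1
    (h.eventually (lt_mem_nhds (ENNReal.ofReal_lt_top (r := |y|))))
  refine ne_top_of_le_ne_top (EReal.coe_ne_top (M * |y|)) (iSup_le fun x => ?_)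
  rcases eq_or_ne (Φ x) ∞ with hx | hx
  · simp [hx]
  rw [coe_sub_toReal hx, EReal.coe_le_coe_iff]
  have h1 : (x : ℝ) * y ≤ x * |y| := mul_le_mul_of_nonneg_left (le_abs_self y) x.2
  rcases le_or_gt M x with hMx | hMx
  · have h2 : (x : ℝ) * |y| ≤ (Φ x).toReal := by
      have h3 := ENNReal.mul_le_of_le_div (hM x hMx).le
      have h4 := ENNReal.toReal_mono hx h3
      rw [ENNReal.toReal_mul, ENNReal.toReal_ofReal (abs_nonneg y), ENNReal.coe_toReal] at h4
      linarith
    have : (0 : ℝ) ≤ M * |y| := by positivity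
    linarith
  · have h2 : (x : ℝ) * |y| ≤ M * |y| :=
      mul_le_mul_of_nonneg_right (NNReal.coe_le_coe.2 hMx.le) (abs_nonneg y)
    linarith [ENNReal.toReal_nonneg (a := Φ x)]

variable (h₀ : ∃ x₀, Φ x₀ < ∞)
  (h₁ : Tendsto (fun x : ℝ≥0 => Φ x / (x : ℝ≥0∞)) atTop (𝓝 ∞))
include h₀ h₁

lemma coe_realFenchel (y : ℝ) : (realFenchel Φ y : EReal) = fenchel Φ y :=
  EReal.coe_toReal (fenchel_ne_top h₁ y) (fenchel_ne_bot h₀ y)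

lemma le_realFenchel {x : ℝ≥0} (hx : Φ x ≠ ∞) (y : ℝ) :
    x * y - (Φ x).toReal ≤ realFenchel Φ y := by
  rw [← EReal.coe_le_coe_iff, coe_realFenchel h₀ h₁, ← coe_sub_toReal hx]
  exact le_iSup (fun x : ℝ≥0 => ((((x : ℝ) * y : ℝ) : EReal) - (Φ x : EReal))) x

lemma realFenchel_le {y c : ℝ} (h : ∀ x : ℝ≥0, Φ x ≠ ∞ → x * y - (Φ x).toReal ≤ c) :
    realFenchel Φ y ≤ c := by
  rw [← EReal.coe_le_coe_iff, coe_realFenchel h₀ h₁]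
  refine iSup_le fun x => ?_
  rcases eq_or_ne (Φ x) ∞ with hx | hx
  · simp [hx]
  · rw [coe_sub_toReal hx, EReal.coe_le_coe_iff]
    exact h x hx

lemma realFenchel_mono : Monotone (realFenchel Φ) := fun _ z hyz =>
  realFenchel_le h₀ h₁ fun x hx =>
    (sub_le_sub_right (mul_le_mul_of_nonneg_left hyz x.2) _).trans (le_realFenchel h₀ h₁ hx z)

lemma convexOn_realFenchel : ConvexOn ℝ Set.univ (realFenchel Φ) := by
  refine ⟨convex_univ, fun y _ z _ a b ha hb hab => realFenchel_le h₀ h₁ fun x hx => ?_⟩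
  have h1 := mul_le_mul_of_nonneg_left (le_realFenchel h₀ h₁ hx y) ha
  have h2 := mul_le_mul_of_nonneg_left (le_realFenchel h₀ h₁ hx z) hb
  simp only [smul_eq_mul]
  have h3 : (x : ℝ) * (a * y + b * z) - (Φ x).toReal =
      a * (x * y - (Φ x).toReal) + b * (x * z - (Φ x).toReal) := by
    linear_combination (Φ x).toReal * hab
  linarith

lemma continuous_realFenchel : Continuous (realFenchel Φ) :=
  (convexOn_realFenchel h₀ h₁).locallyLipschitz.continuous

/-- Monotonicity bounds `Φ*(x + y)` below by `Φ*(x)` and above by `Φ*(x + s)`; midpoint convexity at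
`x + s = (2x + 2s) / 2` then separates `x` from `s`. -/
lemma abs_realFenchel_add_le {x y s : ℝ} (hy : 0 ≤ y) (hys : y ≤ s) :
    |realFenchel Φ (x + y)| ≤
      |realFenchel Φ x| + |realFenchel Φ (2 * x)| + (fenchelYoung Φ (2 * ‖s‖₊)).toReal := by
  have hs : (((2 * ‖s‖₊ : ℝ≥0)) : ℝ) = 2 * s := by
    simp [abs_of_nonneg (hy.trans hys)]
  have h1 : realFenchel Φ (2 * s) ≤ (fenchelYoung Φ (2 * ‖s‖₊)).toReal := by
    rw [fenchelYoung, hs, ← coe_realFenchel h₀ h₁, EReal.real_coe_toENNReal,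
      ENNReal.toReal_ofReal']
    exact le_max_left _ _
  have h2 : realFenchel Φ x ≤ realFenchel Φ (x + y) := realFenchel_mono h₀ h₁ (by linarith)
  have h3 : realFenchel Φ (x + y) ≤ realFenchel Φ (x + s) := realFenchel_mono h₀ h₁ (by linarith)
  have h4 := (convexOn_realFenchel h₀ h₁).2 (Set.mem_univ (2 * x)) (Set.mem_univ (2 * s))
    (by norm_num : (0 : ℝ) ≤ 1 / 2) (by norm_num : (0 : ℝ) ≤ 1 / 2) (by norm_num)
  simp only [smul_eq_mul] at h4
  rw [show 1 / 2 * (2 * x) + 1 / 2 * (2 * s) = x + s by ring] at h4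
  have h5 : 0 ≤ (fenchelYoung Φ (2 * ‖s‖₊)).toReal := ENNReal.toReal_nonneg
  rw [abs_le]
  constructor
  · linarith [neg_abs_le (realFenchel Φ x), abs_nonneg (realFenchel Φ (2 * x))]
  · linarith [le_abs_self (realFenchel Φ (2 * x)), abs_nonneg (realFenchel Φ (2 * x)),
      abs_nonneg (realFenchel Φ x)]

end Conjugate

/-- The expectation of an integrable real random variable. -/
lemma expectation_coe {Ω : Type*} [MeasurableSpace Ω] {P : Measure Ω} {X : Ω → ℝ}
    (hX : Integrable X P) : expectation P (fun ω => (X ω : EReal)) = ((∫ ω, X ω ∂P : ℝ) : EReal) := by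
  have h : ∀ {Z : Ω → ℝ}, Integrable Z P → ∫⁻ ω, ENNReal.ofReal (Z ω) ∂P ≠ ∞ := fun hZ =>
    (lt_of_le_of_lt (lintegral_mono fun ω => by
      rw [← ofReal_norm]
      exact ENNReal.ofReal_le_ofReal (le_abs_self _)) hZ.2).ne
  simp only [expectation, ← EReal.coe_neg, EReal.real_coe_toENNReal]
  rw [integral_eq_lintegral_pos_part_sub_lintegral_neg_part hX, EReal.coe_sub,
    EReal.coe_ennreal_toReal (h hX),
    EReal.coe_ennreal_toReal (h (Z := fun ω => -X ω) hX.neg)]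

/-- Almost minimizers of the norm in a decreasing sequence of midpoint convex sets form a Cauchy
sequence. -/
lemma exists_cauchySeq_mem_of_antitone {H : Type*} [NormedAddCommGroup H] [InnerProductSpace ℝ H]
    {C : ℕ → Set H} (hne : ∀ n, (C n).Nonempty) (hanti : Antitone C)
    (hmid : ∀ n, ∀ a ∈ C n, ∀ b ∈ C n, (2⁻¹ : ℝ) • (a + b) ∈ C n) {R : ℝ}
    (hR : ∀ n, ∀ a ∈ C n, ‖a‖ ≤ R) : ∃ a : ℕ → H, (∀ n, a n ∈ C n) ∧ CauchySeq a := by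
  set d : ℕ → ℝ := fun n => sInf ((fun a => ‖a‖ ^ 2) '' C n) with hd
  have hbdd : ∀ n, BddBelow ((fun a : H => ‖a‖ ^ 2) '' C n) := fun n =>
    ⟨0, by rintro _ ⟨a, -, rfl⟩; positivity⟩
  have hd_le : ∀ n, ∀ a ∈ C n, d n ≤ ‖a‖ ^ 2 := fun n a ha => csInf_le (hbdd n) ⟨a, ha, rfl⟩
  have hd_mono : Monotone d := fun n k hnk =>
    csInf_le_csInf (hbdd n) ((hne k).image _) (Set.image_mono (hanti hnk))
  have hd_bdd : BddAbove (Set.range d) := by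
    refine ⟨R ^ 2, ?_⟩
    rintro _ ⟨n, rfl⟩
    obtain ⟨a, ha⟩ := hne n
    exact (hd_le n a ha).trans (pow_le_pow_left₀ (norm_nonneg a) (hR n a ha) 2)
  have hex : ∀ n : ℕ, ∃ a ∈ C n, ‖a‖ ^ 2 < d n + 1 / ((n : ℝ) + 1) := fun n => by
    obtain ⟨_, ⟨a, ha, rfl⟩, hlt⟩ := exists_lt_of_csInf_lt ((hne n).image fun a => ‖a‖ ^ 2)
      (lt_add_of_pos_right (d n) (Nat.one_div_pos_of_nat (α := ℝ) (n := n)))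
    exact ⟨a, ha, hlt⟩
  choose a ha had using hex
  refine ⟨a, ha, cauchySeq_of_le_tendsto_0'
    (fun n : ℕ => √(2 * ((⨆ k, d k) - d n) + 4 * (1 / ((n : ℝ) + 1)))) (fun n k hnk => ?_) ?_⟩
  · rw [dist_eq_norm]
    refine Real.le_sqrt_of_sq_le ?_
    -- The midpoint lies in `C n`, so its squared norm is at least `d n`. Hence `‖a n - a k‖²` is at
    -- most `2 (d k - d n)` plus error terms bounded by `4 / (n + 1)`.
    have h1 := parallelogram_law_with_norm ℝ (a n) (a k)
    have h2 := hd_le n _ (hmid n _ (ha n) _ (hanti hnk (ha k)))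
    rw [norm_smul, mul_pow] at h2
    norm_num at h2
    have h3 : 1 / ((k : ℝ) + 1) ≤ 1 / ((n : ℝ) + 1) := Nat.one_div_le_one_div hnk
    have h4 := le_ciSup hd_bdd k
    nlinarith [had n, had k]
  · have h1 := tendsto_atTop_ciSup hd_mono hd_bdd
    have h2 := ((tendsto_const_nhds (x := ⨆ k, d k)).sub h1).const_mul 2
    have h3 := (h2.add ((tendsto_one_div_add_atTop_nhds_zero_nat (𝕜 := ℝ)).const_mul 4)).sqrt
    simpa using h3

/-! ### Limits of quantile functions -/

section Limit

variable {ι : Type*} [CompleteLinearOrder ι]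

/-- The regularization `u ↦ sup_{v < u} f v`, with `v` restricted to a countable dense set. -/
def leftRegularization (f : unitInterval → ι) (u : unitInterval) : ι :=
  ⨆ n : {n : ℕ // TopologicalSpace.denseSeq unitInterval n < u},
    f (TopologicalSpace.denseSeq unitInterval n)

variable {f : unitInterval → ι}

lemma leftRegularization_mono (f : unitInterval → ι) : Monotone (leftRegularization f) :=
  fun _ _ huv => iSup_le fun n => le_iSup_of_le
    (⟨n.1, n.2.trans_le huv⟩ : {n : ℕ // TopologicalSpace.denseSeq unitInterval n < _}) le_rfl

lemma leftRegularization_le (hf : Monotone f) (u : unitInterval) : leftRegularization f u ≤ f u :=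
  iSup_le fun n => hf n.2.le

lemma le_leftRegularization (hf : Monotone f) {u v : unitInterval} (h : v < u) :
    f v ≤ leftRegularization f u := by
  obtain ⟨_, ⟨n, rfl⟩, h1, h2⟩ :=
    (TopologicalSpace.denseRange_denseSeq unitInterval).exists_between h
  exact le_iSup_of_le (⟨n, h2⟩ : {n : ℕ // TopologicalSpace.denseSeq unitInterval n < u}) (hf h1.le)

variable [TopologicalSpace ι] [OrderTopology ι]

lemma leftRegularization_leftContinuous (f : unitInterval → ι) (u : unitInterval) :
    ContinuousWithinAt (leftRegularization f) (Set.Iio u) u := by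
  refine leftContinuous_of_le (leftRegularization_mono f) (fun u _ t h => iSup_le fun n => ?_) u
  obtain ⟨v, h1, h2⟩ := exists_between n.2
  exact (le_iSup_of_le (⟨n.1, h1⟩ : {n : ℕ // TopologicalSpace.denseSeq unitInterval n < v})
    le_rfl).trans (h v h2)

/-- Otherwise some `t ∈ D` lies strictly between the two. Then `f n u < t` infinitely often forces
`u ≤ l`, and `t < f n v` infinitely often forces `l ≤ v`, where `l` is the limit at `t`. -/
lemma limsup_le_liminf_of_tendsto_distr {f : ℕ → unitInterval → ι} (hf : ∀ n, Monotone (f n))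
    {D : Set ι} (hD : Dense D) [DenselyOrdered ι]
    (hlim : ∀ t ∈ D, ∃ l, Tendsto (fun n => distr (f n) t) atTop (𝓝 l)) {u v : unitInterval}
    (h : v < u) : limsup (fun n => f n v) atTop ≤ liminf (fun n => f n u) atTop := by
  by_contra hlt
  obtain ⟨t, htD, ht1, ht2⟩ := hD.exists_between (not_le.1 hlt)
  obtain ⟨l, hl⟩ := hlim t htD
  have h1 : (u : ℝ) ≤ l := ge_of_tendsto_of_frequently hl
    ((frequently_lt_of_liminf_lt (by isBoundedDefault) ht1).mono fun n hn => le_distr (hf n) hn.le)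
  have h2 : l ≤ v := le_of_tendsto_of_frequently hl
    ((frequently_lt_of_lt_limsup (by isBoundedDefault) ht2).mono fun n hn => distr_le (hf n) hn)
  exact absurd (h1.trans h2) (not_le.2 h)

/-- Convergence of distribution functions on a dense set implies almost everywhere convergence of
quantile functions. -/
lemma ae_tendsto_leftRegularization [DenselyOrdered ι] [SecondCountableTopology ι]
    {f : ℕ → unitInterval → ι} (hf : ∀ n, Monotone (f n)) {D : Set ι} (hD : Dense D)
    (hlim : ∀ t ∈ D, ∃ l, Tendsto (fun n => distr (f n) t) atTop (𝓝 l)) :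
    ∀ᵐ u : unitInterval, Tendsto (fun n => f n u) atTop
      (𝓝 (leftRegularization (fun u => liminf (fun n => f n u) atTop) u)) := by
  set L : unitInterval → ι := fun u => liminf (fun n => f n u) atTop
  have hL : Monotone L := fun u v huv => liminf_le_liminf (.of_forall fun n => hf n huv)
  -- A monotone function has countably many discontinuities. The endpoints are discarded too, so
  -- that `u` can be approached from both sides.
  have hcount : ({u | ¬ContinuousAt L u} ∪ {0, 1}).Countable :=
    hL.countable_not_continuousAt.union ((Set.countable_singleton _).insert _)
  filter_upwards [hcount.ae_notMem (volume : Measure unitInterval)] with u hu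
  simp only [Set.mem_union, Set.mem_ofPred_eq, Set.mem_insert_iff, Set.mem_singleton_iff, not_or,
    not_not] at hu
  obtain ⟨hc, hu0, hu1⟩ := hu
  have : (𝓝[<] u).NeBot := nhdsLT_neBot_of_exists_lt ⟨0, unitInterval.pos_iff_ne_zero.2 hu0⟩
  have : (𝓝[>] u).NeBot := nhdsGT_neBot_of_exists_gt ⟨1, unitInterval.lt_one_iff_ne_one.2 hu1⟩
  have h1 : L u ≤ leftRegularization L u :=
    le_of_tendsto (hc.tendsto.mono_left nhdsWithin_le_nhds : Tendsto L (𝓝[<] u) _)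
      (eventually_nhdsWithin_of_forall fun v hv => le_leftRegularization hL hv)
  have h2 : limsup (fun n => f n u) atTop ≤ L u :=
    ge_of_tendsto (hc.tendsto.mono_left nhdsWithin_le_nhds : Tendsto L (𝓝[>] u) _)
      (eventually_nhdsWithin_of_forall fun v hv => limsup_le_liminf_of_tendsto_distr hf hD hlim hv)
  exact tendsto_of_le_liminf_of_limsup_le (leftRegularization_le hL u) (h2.trans h1)

/-- Only countable suprema and infima of stopping times occur; the infima require the
right-continuous filtration. -/
lemma IsRandomTime.leftRegularization_liminf {Ω : Type*} [m : MeasurableSpace Ω]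
    [DenselyOrdered ι] [SecondCountableTopology ι] {𝓕 : Filtration ι m}
    (h𝓕 : 𝓕.IsRightContinuous) {τ : ℕ → Ω → unitInterval → ι} (hτ : ∀ n, IsRandomTime 𝓕 (τ n)) :
    IsRandomTime 𝓕 fun ω => leftRegularization fun u => liminf (fun n => τ n ω u) atTop where
  monotone _ := leftRegularization_mono _
  leftContinuous _ := leftRegularization_leftContinuous _
  isTime _ := IsTime.iSup fun _ => IsTime.liminf h𝓕 fun n => (hτ n).isTime _

end Limit

/-! ### Continuity of the expected rewards and existence of a maximizer -/

section Existence

variable {Ω ι : Type*} [m : MeasurableSpace Ω] [CompleteLinearOrder ι] [TopologicalSpace ι]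
  [OrderTopology ι] [SecondCountableTopology ι] [MeasurableSpace ι] [BorelSpace ι] {𝓕 : Filtration ι m} {P : Measure Ω}

section Integrals

variable {Y : ι → Ω → ℝ} {ψ : ℝ → ℝ} {G : Ω → ℝ}

lemma IsRandomTime.integrable (hYm : Measurable fun p : ι × Ω => Y p.1 p.2) (hψ : Continuous ψ)
    (hG : Integrable G P) (hψG : ∀ᵐ ω ∂P, ∀ t, |ψ (Y t ω)| ≤ G ω)
    {τ : Ω → unitInterval → ι} (hτ : IsRandomTime 𝓕 τ) :
    Integrable (fun p : Ω × unitInterval => ψ (Y (τ p.1 p.2) p.1)) (P.prod volume) := by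
  refine (hG.comp_fst volume).mono' (hψ.measurable.comp
    (hYm.comp (hτ.measurable.prodMk measurable_fst))).aestronglyMeasurable ?_
  filter_upwards [Measure.quasiMeasurePreserving_fst.ae hψG] with p hp
  exact hp _

variable [DenselyOrdered ι] [IsProbabilityMeasure P]

lemma IsRandomTime.integral_mixture (hYm : Measurable fun p : ι × Ω => Y p.1 p.2)
    (hψ : Continuous ψ) (hG : Integrable G P) (hψG : ∀ᵐ ω ∂P, ∀ t, |ψ (Y t ω)| ≤ G ω)
    {σ τ : Ω → unitInterval → ι} (hσ : IsRandomTime 𝓕 σ) (hτ : IsRandomTime 𝓕 τ) :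
    ∫ p : Ω × unitInterval, ψ (Y (RandomizedStopping.mixture (σ p.1) (τ p.1) p.2) p.1)
        ∂(P.prod volume) =
      ((∫ p : Ω × unitInterval, ψ (Y (σ p.1 p.2) p.1) ∂(P.prod volume)) +
        ∫ p : Ω × unitInterval, ψ (Y (τ p.1 p.2) p.1) ∂(P.prod volume)) / 2 := by
  have h1 := hσ.integrable hYm hψ hG hψG
  have h2 := hτ.integrable hYm hψ hG hψG
  have h3 := (hσ.mixture hτ).integrable hYm hψ hG hψG
  rw [integral_prod _ h1, integral_prod _ h2, integral_prod _ h3,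
    ← integral_add h1.integral_prod_left h2.integral_prod_left, ← integral_div]
  refine integral_congr_ae ?_
  filter_upwards [hψG] with ω hω
  exact RandomizedStopping.integral_mixture (hσ.monotone ω) (hτ.monotone ω)
    (h := fun t => ψ (Y t ω)) (hψ.measurable.comp (hYm.comp measurable_prodMk_right)) hω

lemma tendsto_integral_of_quasiLeftContinuous (h𝓕 : 𝓕.IsRightContinuous)
    (hYm : Measurable fun p : ι × Ω => Y p.1 p.2)
    (hY : ∀ ω t, ContinuousWithinAt (fun s => Y s ω) (Set.Ioi t) t)
    (hq : ∀ (σ : ℕ → Ω → ι) (τ : Ω → ι), (∀ n, IsTime 𝓕 (σ n)) → IsTime 𝓕 τ →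
      (∀ ω, Monotone fun n => σ n ω) → (∀ ω, Tendsto (fun n => σ n ω) atTop (𝓝 (τ ω))) →
      ∀ᵐ ω ∂P, Tendsto (fun n => Y (σ n ω) ω) atTop (𝓝 (Y (τ ω) ω)))
    (hψ : Continuous ψ) (hG : Integrable G P) (hψG : ∀ᵐ ω ∂P, ∀ t, |ψ (Y t ω)| ≤ G ω)
    {σ : ℕ → Ω → ι} {τ : Ω → ι} (hσ : ∀ n, IsTime 𝓕 (σ n)) (hτ : IsTime 𝓕 τ)
    (hlim : ∀ᵐ ω ∂P, Tendsto (fun n => σ n ω) atTop (𝓝 (τ ω))) :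
    Tendsto (fun n => ∫ ω, ψ (Y (σ n ω) ω) ∂P) atTop (𝓝 (∫ ω, ψ (Y (τ ω) ω) ∂P)) := by
  refine tendsto_of_subseq_tendsto fun ns hns => ?_
  obtain ⟨k, hk⟩ := exists_subseq_tendsto_of_quasiLeftContinuous h𝓕 hY hq
    (fun n => hσ (ns n)) hτ (hlim.mono fun ω hω => hω.comp hns)
  refine ⟨k, tendsto_integral_of_dominated_convergence G (fun n => ?_) hG (fun n => ?_) ?_⟩
  · exact (hψ.measurable.comp (hYm.comp
      ((hσ _).measurable.prodMk measurable_id))).aestronglyMeasurable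
  · filter_upwards [hψG] with ω hω using hω _
  · filter_upwards [hk] with ω hω using (hψ.tendsto _).comp hω

/-- Fubini is used with `u` outside: for fixed `u` these are ordinary stopping times, to which
quasi-left-continuity applies. The two almost-everywhere quantifiers are exchanged accordingly. -/
lemma tendsto_integral_prod_of_quasiLeftContinuous (h𝓕 : 𝓕.IsRightContinuous)
    (hYm : Measurable fun p : ι × Ω => Y p.1 p.2)
    (hY : ∀ ω t, ContinuousWithinAt (fun s => Y s ω) (Set.Ioi t) t)
    (hq : ∀ (σ : ℕ → Ω → ι) (τ : Ω → ι), (∀ n, IsTime 𝓕 (σ n)) → IsTime 𝓕 τ →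
      (∀ ω, Monotone fun n => σ n ω) → (∀ ω, Tendsto (fun n => σ n ω) atTop (𝓝 (τ ω))) →
      ∀ᵐ ω ∂P, Tendsto (fun n => Y (σ n ω) ω) atTop (𝓝 (Y (τ ω) ω)))
    (hψ : Continuous ψ) (hG : Integrable G P) (hψG : ∀ᵐ ω ∂P, ∀ t, |ψ (Y t ω)| ≤ G ω)
    {σ : ℕ → Ω → unitInterval → ι} {τ : Ω → unitInterval → ι} (hσ : ∀ n, IsRandomTime 𝓕 (σ n))
    (hτ : IsRandomTime 𝓕 τ)
    (hlim : ∀ᵐ ω ∂P, ∀ᵐ u, Tendsto (fun n => σ n ω u) atTop (𝓝 (τ ω u))) :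
    Tendsto (fun n => ∫ p : Ω × unitInterval, ψ (Y (σ n p.1 p.2) p.1) ∂(P.prod volume)) atTop
      (𝓝 (∫ p : Ω × unitInterval, ψ (Y (τ p.1 p.2) p.1) ∂(P.prod volume))) := by
  have hi := fun n => (hσ n).integrable hYm hψ hG hψG
  rw [integral_prod_symm _ (hτ.integrable hYm hψ hG hψG)]
  simp only [fun n => integral_prod_symm _ (hi n)]
  rw [Measure.ae_ae_comm (measurableSet_tendsto_fun (fun n => (hσ n).measurable)
    hτ.measurable)] at hlim
  refine tendsto_integral_of_dominated_convergence (fun _ => ∫ ω, G ω ∂P)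
    (fun n => (hi n).integral_prod_right.aestronglyMeasurable) (integrable_const _) (fun n => ?_) ?_
  · refine .of_forall fun u => norm_integral_le_of_norm_le hG ?_
    filter_upwards [hψG] with ω hω using hω _
  · filter_upwards [hlim] with u hu
    exact tendsto_integral_of_quasiLeftContinuous h𝓕 hYm hY hq hψ hG hψG
      (fun n => (hσ n).isTime u) (hτ.isTime u) hu

end Integrals

variable [DenselyOrdered ι]

/-- A decreasing sequence of sets of randomized stopping times which are stable under mixtures
admits a selection with pathwise convergent distribution functions. -/
lemma exists_mem_forall_tendsto_distr [IsFiniteMeasure P] {S : ℕ → Set (Ω → unitInterval → ι)}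
    (hS : ∀ n, ∀ τ ∈ S n, IsRandomTime 𝓕 τ) (hne : ∀ n, (S n).Nonempty) (hanti : Antitone S)
    (hmix : ∀ n, ∀ σ ∈ S n, ∀ τ ∈ S n, (fun ω => mixture (σ ω) (τ ω)) ∈ S n) :
    ∃ (τ : ℕ → Ω → unitInterval → ι) (D : Set ι), (∀ n, τ n ∈ S n) ∧ Dense D ∧
      ∀ᵐ ω ∂P, ∀ t ∈ D, ∃ l, Tendsto (fun n => distr (τ n ω) t) atTop (𝓝 l) := by
  have : Nonempty ι := ⟨⊤⟩
  set d : ℕ → ι := TopologicalSpace.denseSeq ι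
  -- Every `d n` is an atom of this finite measure, so a `ν`-almost everywhere statement holds at
  -- each `d n`.
  set ν : Measure ι := Measure.sum fun n : ℕ => ((2⁻¹ : ℝ≥0∞) ^ n) • Measure.dirac (d n) with hν
  have : IsFiniteMeasure ν := ⟨by
    rw [hν, Measure.sum_apply _ MeasurableSet.univ]
    simp [ENNReal.tsum_geometric]⟩
  have hν_pos : ∀ n, ν {d n} ≠ 0 := fun n h0 => by
    rw [hν, Measure.sum_apply _ (measurableSet_singleton _), ENNReal.tsum_eq_zero] at h0
    simpa using h0 n
  set A : (Ω → unitInterval → ι) → Ω × ι → ℝ := fun τ p => distr (τ p.1) p.2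
  have hA : ∀ τ p, ‖A τ p‖ ≤ 1 := fun τ p => by
    rw [Real.norm_of_nonneg (distr_nonneg _ _)]
    exact distr_le_one _ _
  set C : ℕ → Set (Lp ℝ 2 (P.prod ν)) := fun n => {a | ∃ τ ∈ S n, a =ᵐ[P.prod ν] A τ}
  have hCne : ∀ n, (C n).Nonempty := fun n => by
    obtain ⟨τ, hτ⟩ := hne n
    have hmem : MemLp (A τ) 2 (P.prod ν) :=
      MemLp.of_bound (hS n τ hτ).measurable_distr_uncurry.aestronglyMeasurable 1
        (.of_forall (hA τ))
    exact ⟨hmem.toLp, τ, hτ, hmem.coeFn_toLp⟩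
  obtain ⟨a, haC, ha⟩ := exists_cauchySeq_mem_of_antitone hCne
    (fun n k hnk a ⟨τ, hτ, h⟩ => ⟨τ, hanti hnk hτ, h⟩)
    (fun n a ⟨σ, hσ, hσa⟩ b ⟨τ, hτ, hτb⟩ => ⟨_, hmix n σ hσ τ hτ, by
      filter_upwards [hσa, hτb, Lp.coeFn_smul (2⁻¹ : ℝ) (a + b), Lp.coeFn_add a b]
        with p h1 h2 h3 h4
      rw [h3, Pi.smul_apply, h4, Pi.add_apply, h1, h2]
      simp only [A]
      rw [distr_mixture ((hS n σ hσ).monotone _) ((hS n τ hτ).monotone _), smul_eq_mul]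
      ring⟩)
    (R := (measureUnivNNReal (P.prod ν) : ℝ) ^ (2 : ℝ≥0∞).toReal⁻¹ * 1)
    (fun n a ⟨τ, _, h⟩ => Lp.norm_le_of_ae_bound zero_le_one (by
      filter_upwards [h] with p hp
      rw [hp]
      exact hA τ p))
  obtain ⟨g, hg⟩ := cauchySeq_tendsto_of_complete ha
  obtain ⟨ns, hns, hlim⟩ := (tendstoInMeasure_of_tendsto_Lp hg).exists_seq_tendsto_ae
  choose τ hτS hτa using haC
  -- Since `ns n ≥ n` and `S` is decreasing, the extracted sequence still satisfies `τ (ns n) ∈ S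
  -- n`.
  refine ⟨fun n => τ (ns n), Set.range d, fun n => hanti (hns.id_le n) (hτS _),
    TopologicalSpace.denseRange_denseSeq ι, ?_⟩
  have hae : ∀ᵐ p ∂P.prod ν, ∃ l, Tendsto (fun n => distr (τ (ns n) p.1) p.2) atTop (𝓝 l) := by
    filter_upwards [hlim, ae_all_iff.2 fun n => hτa (ns n)] with p h1 h2
    exact ⟨_, h1.congr fun n => h2 n⟩
  filter_upwards [Measure.ae_ae_of_ae_prod hae] with ω hω
  rintro _ ⟨n, rfl⟩
  by_contra hn
  exact hν_pos n (measure_mono_null (Set.singleton_subset_iff.2 hn) hω)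

/-- Existence of an optimal randomized stopping time for the worst case among a family of
continuous dominated rewards. -/
theorem exists_isRandomTime_forall_iInf_le [IsProbabilityMeasure P] {X : Type*}
    {Y : ι → Ω → ℝ} {ψ : X → ℝ → ℝ} {G : X → Ω → ℝ} (h𝓕 : 𝓕.IsRightContinuous)
    (hYm : ∀ t, Measurable (Y t))
    (hY : ∀ ω t, ContinuousWithinAt (fun s => Y s ω) (Set.Ioi t) t)
    (hq : ∀ (σ : ℕ → Ω → ι) (τ : Ω → ι), (∀ n, IsTime 𝓕 (σ n)) → IsTime 𝓕 τ →
      (∀ ω, Monotone fun n => σ n ω) → (∀ ω, Tendsto (fun n => σ n ω) atTop (𝓝 (τ ω))) →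
      ∀ᵐ ω ∂P, Tendsto (fun n => Y (σ n ω) ω) atTop (𝓝 (Y (τ ω) ω)))
    (hψ : ∀ x, Continuous (ψ x)) (hG : ∀ x, Integrable (G x) P)
    (hψG : ∀ x, ∀ᵐ ω ∂P, ∀ t, |ψ x (Y t ω)| ≤ G x ω) :
    ∃ τ₀ : Ω → unitInterval → ι, IsRandomTime 𝓕 τ₀ ∧ ∀ τ, IsRandomTime 𝓕 τ →
      ⨅ x, ((∫ p : Ω × unitInterval, ψ x (Y (τ p.1 p.2) p.1) ∂(P.prod volume) : ℝ) : EReal) ≤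
      ⨅ x, ((∫ p : Ω × unitInterval, ψ x (Y (τ₀ p.1 p.2) p.1) ∂(P.prod volume) : ℝ) : EReal) := by
  have hYm' := measurable_uncurry_of_rightContinuous hYm hY
  set J : (Ω → unitInterval → ι) → X → ℝ := fun τ x =>
    ∫ p : Ω × unitInterval, ψ x (Y (τ p.1 p.2) p.1) ∂(P.prod volume)
  set V : (Ω → unitInterval → ι) → EReal := fun τ => ⨅ x, (J τ x : EReal)
  obtain ⟨s, hs, hslim, hsmem⟩ := exists_seq_tendsto_sSup
    (S := V '' {τ | IsRandomTime 𝓕 τ}) ⟨_, _, isRandomTime_bot, rfl⟩ (OrderTop.bddAbove _)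
  obtain ⟨τ, D, hτS, hD, hτD⟩ := exists_mem_forall_tendsto_distr (P := P) (𝓕 := 𝓕)
    (S := fun n => {τ | IsRandomTime 𝓕 τ ∧ s n ≤ V τ}) (fun n τ hτ => hτ.1)
    (fun n => by
      obtain ⟨τ, hτ, h⟩ := hsmem n
      exact ⟨τ, hτ, h.ge⟩)
    (fun n k hnk τ hτ => ⟨hτ.1, (hs hnk).trans hτ.2⟩)
    -- An average is at least the smaller of its two terms, and both exceed the level `s n` for
    -- every `x`.
    (fun n σ hσ τ hτ => ⟨hσ.1.mixture hτ.1, le_iInf fun x => by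
      have h1 : min (J σ x) (J τ x) ≤ J (fun ω => mixture (σ ω) (τ ω)) x := by
        rw [show J (fun ω => mixture (σ ω) (τ ω)) x = (J σ x + J τ x) / 2 from
          IsRandomTime.integral_mixture hYm' (hψ x) (hG x) (hψG x) hσ.1 hτ.1]
        linarith [min_le_left (J σ x) (J τ x), min_le_right (J σ x) (J τ x)]
      refine le_trans ?_ (EReal.coe_le_coe_iff.2 h1)
      rcases min_choice (J σ x) (J τ x) with h | h
      · rw [h]
        exact hσ.2.trans (iInf_le _ x)
      · rw [h]
        exact hτ.2.trans (iInf_le _ x)⟩)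
  have hτ₀ := IsRandomTime.leftRegularization_liminf h𝓕 fun n => (hτS n).1
  refine ⟨_, hτ₀, fun σ hσ =>
    le_trans (le_sSup (Set.mem_image_of_mem V hσ)) (le_iInf fun x => ?_)⟩
  -- The inequality `s n ≤ J (τ n) x` passes to the limit for each `x` separately; no uniformity in
  -- `x` is needed.
  refine le_of_tendsto_of_tendsto' hslim ((continuous_coe_real_ereal.tendsto _).comp
    (tendsto_integral_prod_of_quasiLeftContinuous h𝓕 hYm' hY hq (hψ x) (hG x) (hψG x)
      (fun n => (hτS n).1) hτ₀ ?_)) fun n => (hτS n).2.trans (iInf_le _ x)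
  filter_upwards [hτD] with ω hω
  exact ae_tendsto_leftRegularization (fun n => (hτS n).1.monotone ω) hD hω

end Existence

/-! ### Transfer to the time interval and the main theorem -/

section Interval

variable {Ω : Type*} [m : MeasurableSpace Ω] {T : ℝ} [Fact ((0 : ℝ) ≤ T)]
  {𝓕 : Filtration (Set.Icc (0 : ℝ) T) m}

lemma isStopping_iff_isTime {τ : Ω → Set.Icc (0 : ℝ) T} : IsStopping 𝓕 τ ↔ IsTime 𝓕 τ := by
  simp only [IsStopping, IsStoppingTime, IsTime, WithTop.coe_le_coe]

lemma isRandomizedStopping_iff_isRandomTime {τ : Ω → unitInterval → Set.Icc (0 : ℝ) T} :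
    IsRandomizedStopping 𝓕 τ ↔ IsRandomTime 𝓕 τ :=
  ⟨fun h => ⟨h.1, h.2, fun u => isStopping_iff_isTime.1 (h.3 u)⟩,
    fun h => ⟨h.1, h.2, fun u => isStopping_iff_isTime.2 (h.3 u)⟩⟩

end Interval

lemma measurable_fenchelYoung {Φ : ℝ≥0 → ℝ≥0∞} (h₀ : ∃ x₀, Φ x₀ < ∞)
    (h₁ : Tendsto (fun x : ℝ≥0 => Φ x / (x : ℝ≥0∞)) atTop (𝓝 ∞)) :
    Measurable (fenchelYoung Φ) := by
  have : fenchelYoung Φ = fun y : ℝ≥0 => ENNReal.ofReal (realFenchel Φ y) := by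
    ext y
    rw [fenchelYoung, ← coe_realFenchel h₀ h₁, EReal.real_coe_toENNReal]
  rw [this]
  exact ((continuous_realFenchel h₀ h₁).measurable.comp measurable_subtype_coe).ennreal_ofReal

end RandomizedStopping

end

theorem proposition6p1 {Ω : Type*} [m : MeasurableSpace Ω] (P : Measure Ω) [IsProbabilityMeasure P]
    (T : ℝ) (hT : 0 < T) (𝓕 : Filtration (Set.Icc (0 : ℝ) T) m)
    (h𝓕_right : 𝓕.IsRightContinuous)
    (h𝓕_trivial : ∀ s, MeasurableSet[𝓕 ⟨0, Set.left_mem_Icc.2 hT.le⟩] s → P s = 0 ∨ P s = 1)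
    (h𝓕_null : ∀ s, MeasurableSet s → P s = 0 →
      MeasurableSet[𝓕 ⟨0, Set.left_mem_Icc.2 hT.le⟩] s)
    (h𝓕_gen : RandomizedStopping.CountablyGeneratedModNull P (𝓕 ⟨T, Set.right_mem_Icc.2 hT.le⟩))
    (Φ : ℝ≥0 → ℝ≥0∞) (hΦ_lsc : LowerSemicontinuous Φ) (hΦ_convex : ConvexOn ℝ≥0 Set.univ Φ)
    (hΦ_finite : ∃ x₀ : ℝ≥0, 0 < x₀ ∧ Φ x₀ < ∞) (hΦ_inf : ⨅ x : ℝ≥0, Φ x = 0)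
    (hΦ_growth : Tendsto (fun x : ℝ≥0 => Φ x / (x : ℝ≥0∞)) atTop (𝓝 ∞))
    (Y : Set.Icc (0 : ℝ) T → Ω → ℝ) (hY_adapted : Adapted 𝓕 Y) (hY_nonneg : ∀ t ω, 0 ≤ Y t ω)
    (hY_right : ∀ ω t, ContinuousWithinAt (fun s => Y s ω) (Set.Ioi t) t)
    (hY_bdd : ∀ᵐ ω ∂P, BddAbove (Set.range fun t => Y t ω))
    (hY_heart : RandomizedStopping.MemOrliczHeart P (RandomizedStopping.fenchelYoung Φ)
      (fun ω => ⨆ t, Y t ω))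
    (hY_qlc : RandomizedStopping.QuasiLeftContinuous P 𝓕 Y) :
    ∃ τ₀ : Ω → unitInterval → Set.Icc (0 : ℝ) T,
      RandomizedStopping.IsRandomizedStopping 𝓕 τ₀ ∧
      RandomizedStopping.value P Φ Y τ₀ =
        ⨆ τ ∈ {τ : Ω → unitInterval → Set.Icc (0 : ℝ) T |
          RandomizedStopping.IsRandomizedStopping 𝓕 τ}, RandomizedStopping.value P Φ Y τ := by
  open RandomizedStopping in
  have : Fact ((0 : ℝ) ≤ T) := ⟨hT.le⟩
  have h₀ : ∃ x₀, Φ x₀ < ∞ := hΦ_finite.imp fun _ h => h.2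
  have hφ := continuous_realFenchel h₀ hΦ_growth
  set S : Ω → ℝ := fun ω => ⨆ t, Y t ω
  -- The factor `2` comes from the midpoint convexity bound in `abs_realFenchel_add_le`; the Orlicz
  -- heart condition at `c = 2` gives integrability.
  set G : Ω → ℝ := fun ω => (fenchelYoung Φ (2 * ‖S ω‖₊)).toReal
  have hG : Integrable G P := integrable_toReal_of_lintegral_ne_top
    ((measurable_fenchelYoung h₀ hΦ_growth).comp_aemeasurable (hY_heart.1.nnnorm.const_mul 2))
    (hY_heart.2 2 two_pos).ne
  set ψ : ℝ → ℝ → ℝ := fun x y => realFenchel Φ (x + y) - x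
  have hψ : ∀ x, Continuous (ψ x) := fun x =>
    (hφ.comp (continuous_const_add x)).sub continuous_const
  have hGx : ∀ x, Integrable
      (fun ω => |realFenchel Φ x| + |realFenchel Φ (2 * x)| + G ω + |x|) P := fun x =>
    ((integrable_const _).add hG).add (integrable_const _)
  have hψG : ∀ x, ∀ᵐ ω ∂P, ∀ t, |ψ x (Y t ω)| ≤
      |realFenchel Φ x| + |realFenchel Φ (2 * x)| + G ω + |x| := fun x => by
    filter_upwards [hY_bdd] with ω hω t
    exact (abs_sub _ _).trans (add_le_add_left (abs_realFenchel_add_le h₀ hΦ_growth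
      (hY_nonneg t ω) (le_ciSup hω t)) _)
  have hYm : ∀ t, Measurable (Y t) := fun t => (hY_adapted t).mono (𝓕.le t) le_rfl
  -- Domination makes every reward integrable, so the extended real expectation is an ordinary
  -- integral.
  have hvalue : ∀ τ, IsRandomizedStopping 𝓕 τ → value P Φ Y τ =
      ⨅ x, ((∫ p : Ω × unitInterval, ψ x (Y (τ p.1 p.2) p.1) ∂(P.prod volume) : ℝ) : EReal) := by
    intro τ hτ
    refine iInf_congr fun x => ?_
    rw [← expectation_coe ((isRandomizedStopping_iff_isRandomTime.1 hτ).integrable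
      (measurable_uncurry_of_rightContinuous hYm hY_right) (hψ x) (hGx x) (hψG x))]
    simp only [ψ, EReal.coe_sub, coe_realFenchel h₀ hΦ_growth]
  obtain ⟨τ₀, hτ₀, hmax⟩ := exists_isRandomTime_forall_iInf_le h𝓕_right hYm hY_right
    (fun σ τ hσ hτ => hY_qlc σ τ (fun n => isStopping_iff_isTime.2 (hσ n))
      (isStopping_iff_isTime.2 hτ)) hψ hGx hψG
  have hτ₀' := isRandomizedStopping_iff_isRandomTime.2 hτ₀
  refine ⟨τ₀, hτ₀', le_antisymm (le_iSup₂_of_le τ₀ hτ₀' le_rfl) (iSup₂_le fun τ hτ => ?_)⟩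
  rw [hvalue τ hτ, hvalue τ₀ hτ₀']
  exact hmax τ (isRandomizedStopping_iff_isRandomTime.1 hτ)
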